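/- A quantale is a complete lattice $A$ (with bottom $0$ and top $1$) with an associative multiplication that distributes over arbitrary joins in each variable. Let $A$ be a quantale that is commutative and integral ($1$ is the unit of the multiplication). Let $K(A)$ be the set of compact elements of $A$, and suppose that $A$ is coherent: every element of $A$ is a join of compact elements, $1\in K(A)$, and $K(A)$ is closed under multiplication. For $c\in A$ put $c^{\perp}=\bigvee\{x\in A\mid cx=0\}$. An element $a\in A$ is pure if $a\vee c^{\perp}=1$ for every $c\in K(A)$ with $c\le a$, and $A$ is a $PF$-quantale if $c^{\perp}$ is pure for every $c\in K(A)$. Let $Spec(A)$ be the set of $m$-prime elements, i.e. of all $p<1$ in $A$ such that $xy\le p$ implies $x\le p$ or $y\le p$ for all $x,y\in A$, and let $Min(A)$ be the set of minimal elements of $Spec(A)$. Let $Spec_Z(A)$ be $Spec(A)$ with the topology whose closed sets are the sets $V(x)=\{p\in Spec(A)\mid x\le p\}$, $x\in A$, and let $Spec_F(A)$ be $Spec(A)$ with the flat topology, which has as a basis of open sets the complements of the compact open subsets of $Spec_Z(A)$. **Theorem 6.10.** Let $A$ be a coherent $PF$-quantale. An element $a\in A$ is pure if and only if $a=\bigwedge(Min(A)\cap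 E)$ for some closed subset $E$ of $Spec_F(A)$ (where $\bigwedge\emptyset=1$). -/

import Mathlib

open scoped Topology

namespace Quantale

/-- A (unital) quantale is integral if the unit of the multiplication is the top element. -/
class IsIntegral (A : Type*) [CommMonoid A] [CompleteLattice A] : Prop where
  one_eq_top : (1 : A) = ⊤

/-- A quantale is coherent if it is algebraic (every element is a join of compact elements),
its top element is compact, and its compact elements are closed under multiplication. -/
class IsCoherent (A : Type*) [CommMonoid A] [CompleteLattice A] : Prop
    extends IsCompactlyGenerated A where
  isCompactElement_top : IsCompactElement (⊤ : A)
  isCompactElement_mul : ∀ c d : A,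
    IsCompactElement c → IsCompactElement d → IsCompactElement (c * d)

section Elements

variable {A : Type*} [CommMonoid A] [CompleteLattice A]

/-- The negation `a^⊥ = a → 0`, that is, the join of all `x` with `a * x ≤ ⊥`. -/
def perp (a : A) : A := rightMulResiduation a ⊥

/-- An element `a` is pure if `a ∨ c^⊥ = 1` for every compact `c ≤ a`. -/
def IsPure (a : A) : Prop := ∀ c : A, IsCompactElement c → c ≤ a → a ⊔ perp c = ⊤

/-- The `m`-prime elements. -/
def IsMPrime (p : A) : Prop := p < ⊤ ∧ ∀ a b : A, a * b ≤ p → a ≤ p ∨ b ≤ p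

end Elements

/-- A quantale is a `PF`-quantale if `c^⊥` is pure for every compact `c`. -/
def IsPF (A : Type*) [CommMonoid A] [CompleteLattice A] : Prop :=
  ∀ c : A, IsCompactElement c → IsPure (perp c)

/-- The set `Spec(A)` of `m`-prime elements, with the order of `A`. -/
abbrev Spec (A : Type*) [CommMonoid A] [CompleteLattice A] : Type _ := {p : A // IsMPrime p}

/-- The set `Min(A)` of minimal `m`-prime elements. -/
def minSpec (A : Type*) [CommMonoid A] [CompleteLattice A] : Set (Spec A) := {p | IsMin p}

/-- `V(a)`, the set of `m`-prime elements above `a`. -/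
def vanishing {A : Type*} [CommMonoid A] [CompleteLattice A] (a : A) : Set (Spec A) :=
  {p | a ≤ p.1}

section Topology

variable (A : Type*) [CommMonoid A] [CompleteLattice A] [IsQuantale A] [IsIntegral A]

/-- The spectral (Zariski) topology on `Spec(A)`: the closed sets are the sets `V(a)`. -/
@[reducible] def zariskiTopology : TopologicalSpace (Spec A) :=
  TopologicalSpace.ofClosed {F | ∃ a : A, F = vanishing a}
    ⟨⊤, by
      ext p
      simp only [vanishing, Set.mem_empty_iff_false, Set.mem_ofPred_eq, false_iff, top_le_iff]
      exact p.2.1.ne⟩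
    (by
      intro S hS
      refine ⟨sSup {a : A | vanishing a ∈ S}, ?_⟩
      ext p
      simp only [vanishing, Set.mem_sInter, Set.mem_ofPred_eq, sSup_le_iff]
      constructor
      · intro h a ha
        exact h _ ha
      · intro h F hF
        obtain ⟨a, rfl⟩ := hS hF
        exact h a hF)
    (by
      rintro _ ⟨a, rfl⟩ _ ⟨b, rfl⟩
      refine ⟨a * b, ?_⟩
      ext p
      simp only [vanishing, Set.mem_union, Set.mem_ofPred_eq]
      constructor
      · have h1 : a * b ≤ a := by
          calc a * b ≤ a * 1 := mul_le_mul_right (IsIntegral.one_eq_top (A := A) ▸ le_top) a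
            _ = a := mul_one a
        have h2 : a * b ≤ b := by
          calc a * b ≤ 1 * b := mul_le_mul_left (IsIntegral.one_eq_top (A := A) ▸ le_top) b
            _ = b := one_mul b
        rintro (h | h)
        · exact h1.trans h
        · exact h2.trans h
      · exact p.2.2 a b)

/-- The flat topology on `Spec(A)`: it has as a basis the complements of the compact open
subsets of `Spec(A)` in the spectral topology. -/
@[reducible] def flatTopology : TopologicalSpace (Spec A) :=
  TopologicalSpace.generateFrom
    {U | IsOpen[zariskiTopology A] Uᶜ ∧ @IsCompact _ (zariskiTopology A) Uᶜ}

end Topology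

end Quantale

namespace Quantale

/-! In a `PF`-quantale, `kernel m` is the least `m`-prime below the `m`-prime `m`
(`isMPrime_kernel`, `kernel_le`), and membership of a compact element in it has a single
annihilating witness (`le_kernel_iff`). If `a` is pure, take `E = V(a)`: it is flat-closed, `a` is a
meet of primes because it is radical, and each prime above `a` may be replaced by a minimal one,
still above `a`. Conversely, if `a = ⋀(Min(A) ∩ E)` and `a ∨ c^⊥ ≤ m` with `c ≤ a` compact, then
`kernel m ∉ E`. A basic flat neighbourhood `V(d)` of `kernel m` misses `E`, and a witness `y ≰ m`
with `dy = 0` lies below all of `E`, so `y ≤ a ≤ m`, a contradiction. -/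

theorem exists_isCompactElement_le_not_le {A : Type*} [CompleteLattice A]
    [IsCompactlyGenerated A] {a b : A} (h : ¬ a ≤ b) :
    ∃ c : A, IsCompactElement c ∧ c ≤ a ∧ ¬ c ≤ b := by
  by_contra! H
  exact h (le_iff_compact_le_imp.2 H)

variable {A : Type*} [CommMonoid A] [CompleteLattice A]

theorem isCompactElement_pow [IsIntegral A] [IsCoherent A] {c : A} (hc : IsCompactElement c)
    (n : ℕ) : IsCompactElement (c ^ n) := by
  induction n with
  | zero =>
    rw [pow_zero, IsIntegral.one_eq_top]
    exact IsCoherent.isCompactElement_top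
  | succ n ih =>
    rw [pow_succ]
    exact IsCoherent.isCompactElement_mul _ _ ih hc

/-- Every `m`-prime element lies above a minimal one. -/
theorem exists_mem_minSpec_le (p : Spec A) : ∃ q ∈ minSpec A, q ≤ p := by
  have hinf : ∀ C : Set (Spec A), IsChain (· ≤ ·) C → C.Nonempty →
      IsMPrime (sInf (Subtype.val '' C)) := by
    intro C hC ⟨r, hr⟩
    refine ⟨(sInf_le (Set.mem_image_of_mem _ hr)).trans_lt r.2.1, fun x y hxy => ?_⟩
    by_contra! h
    simp only [le_sInf_iff, Set.forall_mem_image, not_forall] at h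
    obtain ⟨⟨s, hs, hxs⟩, t, ht, hyt⟩ := h
    obtain ⟨u, hu, hus, hut⟩ : ∃ u ∈ C, u.1 ≤ s.1 ∧ u.1 ≤ t.1 := by
      rcases hC.total hs ht with h | h
      · exact ⟨s, hs, le_rfl, h⟩
      · exact ⟨t, ht, h, le_rfl⟩
    rcases u.2.2 x y (hxy.trans (sInf_le (Set.mem_image_of_mem _ hu))) with h | h
    · exact hxs (h.trans hus)
    · exact hyt (h.trans hut)
  obtain ⟨q, hqp, hq⟩ := zorn_le_nonempty₀ (α := (Spec A)ᵒᵈ) Set.univ (by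
    intro C _ hC y hy
    refine ⟨(⟨_, hinf C hC.symm ⟨y, hy⟩⟩ : Spec A), Set.mem_univ _, fun z hz => ?_⟩
    exact sInf_le (Set.mem_image_of_mem Subtype.val hz)) p (Set.mem_univ _)
  exact ⟨q, fun r hr => hq.2 (Set.mem_univ _) hr, hqp⟩

theorem IsMPrime.le_of_pow_le [IsIntegral A] {p c : A} (hp : IsMPrime p) {n : ℕ}
    (h : c ^ n ≤ p) : c ≤ p := by
  induction n with
  | zero =>
    rw [pow_zero, IsIntegral.one_eq_top] at h
    exact le_top.trans h
  | succ n ih =>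
    rw [pow_succ] at h
    exact (hp.2 _ _ h).elim ih id

/-! ### Kernels of `m`-primes -/

/-- The join of the elements annihilated by some element not below `m`. -/
def kernel (m : A) : A := sSup {x | ∃ y, ¬ y ≤ m ∧ x * y ≤ ⊥}

theorem kernel_le {m p : A} (hp : IsMPrime p) (hpm : p ≤ m) : kernel m ≤ p :=
  sSup_le fun _ ⟨_, hy, hxy⟩ =>
    (hp.2 _ _ (hxy.trans bot_le)).resolve_right fun h => hy (h.trans hpm)

variable [IsQuantale A]

theorem le_perp {a x : A} : x ≤ perp a ↔ a * x ≤ ⊥ :=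
  rightMulResiduation_le_iff_mul_le

/-- The family defining `kernel m` is directed, since the product of two witnesses is again not
below `m`; compactness of `c` then picks one member. -/
theorem le_kernel_iff {m c : A} (hm : IsMPrime m) (hc : IsCompactElement c) :
    c ≤ kernel m ↔ ∃ y, ¬ y ≤ m ∧ c * y ≤ ⊥ := by
  refine ⟨fun h => ?_, fun h => le_sSup h⟩
  obtain ⟨x, ⟨y, hy, hxy⟩, hcx⟩ := hc {x | ∃ y, ¬ y ≤ m ∧ x * y ≤ ⊥} _
    ⟨⊥, ⊤, hm.1.not_ge, bot_mul.le⟩ (by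
      rintro x₁ ⟨y₁, hy₁, h₁⟩ x₂ ⟨y₂, hy₂, h₂⟩
      refine ⟨x₁ ⊔ x₂, ⟨y₁ * y₂, fun h => (hm.2 _ _ h).elim hy₁ hy₂, ?_⟩,
        le_sup_left, le_sup_right⟩
      rw [sup_mul_distrib]
      refine sup_le ?_ ?_
      · rw [← mul_assoc]
        exact (mul_le_mul_left h₁ _).trans bot_mul.le
      · rw [mul_left_comm]
        exact (mul_le_mul_right h₂ _).trans mul_bot.le)
    (isLUB_sSup _) h
  exact ⟨y, hy, (mul_le_mul_left hcx y).trans hxy⟩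

theorem isMPrime_kernel [IsCoherent A] (hA : IsPF A) {m : A} (hm : IsMPrime m) :
    IsMPrime (kernel m) := by
  refine ⟨(kernel_le hm le_rfl).trans_lt hm.1, fun a b hab => ?_⟩
  by_contra! hn
  obtain ⟨x, hx, hxa, hxn⟩ := exists_isCompactElement_le_not_le hn.1
  obtain ⟨y, hy, hyb, hyn⟩ := exists_isCompactElement_le_not_le hn.2
  obtain ⟨w, hw, hxyw⟩ := (le_kernel_iff hm (IsCoherent.isCompactElement_mul x y hx hy)).1
    ((mul_le_mul' hxa hyb).trans hab)
  obtain ⟨z, hz, hzw, hzm⟩ := exists_isCompactElement_le_not_le hw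
  have hyz : y * z ≤ perp x := by
    rw [le_perp, ← mul_assoc]
    exact (mul_le_mul_right hzw _).trans hxyw
  -- Purity gives `x^⊥ ∨ (yz)^⊥ = 1`, so one of the two is not below `m` and puts `x` or `y` in the
  -- kernel.
  have htop := hA x hx _ (IsCoherent.isCompactElement_mul y z hy hz) hyz
  refine hm.1.not_ge (htop.ge.trans (sup_le ?_ ?_))
  · by_contra h
    exact hxn ((le_kernel_iff hm hx).2 ⟨_, h, le_perp.1 le_rfl⟩)
  · by_contra h
    refine hyn ((le_kernel_iff hm hy).2 ⟨z * perp (y * z), fun h' => ?_, ?_⟩)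
    · exact (hm.2 _ _ h').elim hzm h
    · rw [← mul_assoc]
      exact le_perp.1 le_rfl

theorem kernel_mem_minSpec [IsCoherent A] (hA : IsPF A) {m : A} (hm : IsMPrime m) :
    (⟨kernel m, isMPrime_kernel hA hm⟩ : Spec A) ∈ minSpec A :=
  fun q hq => kernel_le q.2 (le_trans (b := kernel m) hq (kernel_le hm le_rfl))

theorem IsPure.le_of_le_isMPrime [IsCoherent A] {a p q : A} (ha : IsPure a) (hp : IsMPrime p)
    (hq : IsMPrime q) (hqp : q ≤ p) (hap : a ≤ p) : a ≤ q := by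
  refine le_iff_compact_le_imp.2 fun d hd hda => ?_
  refine (hq.2 d (perp d) ((le_perp.1 le_rfl).trans bot_le)).resolve_right fun h => ?_
  exact hp.1.not_ge ((ha d hd hda).ge.trans (sup_le hap (h.trans hqp)))

variable [IsIntegral A]

/-! ### Separation by primes and radicality -/

theorem mul_le_left (x y : A) : x * y ≤ x := by
  calc x * y ≤ x * 1 := by
        rw [IsIntegral.one_eq_top (A := A)]
        gcongr
        exact le_top
    _ = x := mul_one x

theorem mul_le_right (x y : A) : x * y ≤ y := by
  rw [mul_comm]
  exact mul_le_left y x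

theorem sup_mul_sup_le (p x y : A) : (p ⊔ x) * (p ⊔ y) ≤ p ⊔ x * y := by
  rw [mul_sup_distrib, sup_mul_distrib, sup_mul_distrib]
  refine sup_le (sup_le ?_ ?_) (sup_le ?_ ?_)
  · exact (mul_le_left _ _).trans le_sup_left
  · exact (mul_le_right _ _).trans le_sup_left
  · exact (mul_le_left _ _).trans le_sup_left
  · exact le_sup_right

/-- If `a ∨ d = 1` and `x * d = 0`, then `x ≤ a`. -/
theorem le_of_sup_eq_top {a d x : A} (h : a ⊔ d = ⊤) (hx : x * d ≤ ⊥) : x ≤ a := by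
  calc x = x * (a ⊔ d) := by rw [h, ← IsIntegral.one_eq_top, mul_one]
    _ = x * a ⊔ x * d := mul_sup_distrib
    _ ≤ a := sup_le (mul_le_right _ _) (hx.trans bot_le)

/-- If no power of the compact element `c` lies below `a`, some `m`-prime element above `a` is not
above `c`. -/
theorem exists_isMPrime_not_le [IsCoherent A] {a c : A} (hc : IsCompactElement c)
    (h : ∀ n : ℕ, ¬ c ^ n ≤ a) : ∃ p : A, IsMPrime p ∧ a ≤ p ∧ ¬ c ≤ p := by
  obtain ⟨p, hap, hp, hmax⟩ := zorn_le_nonempty₀ {x : A | ∀ n : ℕ, ¬ c ^ n ≤ x} (by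
    intro C hC hch y hy
    refine ⟨sSup C, fun n hn => ?_, fun z hz => le_sSup hz⟩
    obtain ⟨x, hx, hnx⟩ :=
      isCompactElement_pow hc n C _ ⟨y, hy⟩ hch.directedOn (isLUB_sSup C) hn
    exact hC hx n hnx) a h
  refine ⟨p, ⟨lt_top_iff_ne_top.2 ?_, fun x y hxy => ?_⟩, hap, fun hcp => hp 1 (by simpa)⟩
  · rintro rfl
    exact hp 0 le_top
  · by_contra! hn
    have key : ∀ z : A, ¬ z ≤ p → ∃ n : ℕ, c ^ n ≤ p ⊔ z := by
      intro z hz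
      by_contra! H
      exact hz (le_sup_right.trans (hmax H le_sup_left))
    obtain ⟨n, hn'⟩ := key x hn.1
    obtain ⟨m, hm⟩ := key y hn.2
    refine hp (n + m) ?_
    rw [pow_add]
    exact (mul_le_mul' hn' hm).trans ((sup_mul_sup_le p x y).trans (sup_le le_rfl hxy))

theorem exists_isMPrime_of_ne_top [IsCoherent A] {a : A} (h : a ≠ ⊤) :
    ∃ p : A, IsMPrime p ∧ a ≤ p := by
  obtain ⟨p, hp, hap, -⟩ := exists_isMPrime_not_le (a := a)
    (IsCoherent.isCompactElement_top (A := A)) (fun n => by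
      rw [← IsIntegral.one_eq_top, one_pow, IsIntegral.one_eq_top, top_le_iff]
      exact h)
  exact ⟨p, hp, hap⟩

/-- A coherent `PF`-quantale is reduced. -/
theorem eq_bot_of_pow_le_bot [IsCoherent A] (hA : IsPF A) {c : A} (hc : IsCompactElement c)
    {n : ℕ} (h : c ^ n ≤ ⊥) : c ≤ ⊥ := by
  by_contra hcb
  have hne : perp c ≠ ⊤ := fun ht => hcb <| by
    simpa [← IsIntegral.one_eq_top] using le_perp.1 ht.ge
  obtain ⟨m, hm, hcm⟩ := exists_isMPrime_of_ne_top hne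
  obtain ⟨y, hy, hcy⟩ := (le_kernel_iff hm hc).1
    ((isMPrime_kernel hA hm).le_of_pow_le (h.trans bot_le))
  exact hy ((le_perp.2 hcy).trans hcm)

/-- As `a ∨ (c^n)^⊥ = 1`, it suffices that `c (c^n)^⊥ = 0`: a compact `x` below this product has
`x^(n+1) = 0`, and `A` is reduced. -/
theorem IsPure.le_of_pow_le [IsCoherent A] (hA : IsPF A) {a c : A} (ha : IsPure a)
    (hc : IsCompactElement c) {n : ℕ} (h : c ^ n ≤ a) : c ≤ a := by
  refine le_of_sup_eq_top (ha _ (isCompactElement_pow hc n) h) (le_iff_compact_le_imp.2 ?_)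
  intro x hx hxc
  refine eq_bot_of_pow_le_bot hA hx (n := n + 1) ?_
  have hxc' : x ≤ c := hxc.trans (mul_le_left _ _)
  have hxp : x ≤ perp (c ^ n) := hxc.trans (mul_le_right _ _)
  rw [pow_succ]
  exact (mul_le_mul_left (pow_le_pow_left' hxc' n) x).trans (le_perp.1 hxp)

theorem IsPure.eq_sInf_minSpec [IsCoherent A] (hA : IsPF A) {a : A} (ha : IsPure a) :
    a = sInf (Subtype.val '' (minSpec A ∩ vanishing a)) := by
  refine le_antisymm (le_sInf ?_) (le_iff_compact_le_imp.2 fun c hc h => ?_)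
  · rintro _ ⟨p, ⟨-, hp⟩, rfl⟩
    exact hp
  · by_contra hca
    obtain ⟨p, hp, hap, hcp⟩ :=
      exists_isMPrime_not_le hc fun n hn => hca (ha.le_of_pow_le hA hc hn)
    obtain ⟨q, hq, hqp⟩ := exists_mem_minSpec_le (⟨p, hp⟩ : Spec A)
    exact hcp ((h.trans (sInf_le ⟨q, ⟨hq, ha.le_of_le_isMPrime hp q.2 hqp hap⟩, rfl⟩)).trans hqp)

/-! ### The spectral and flat topologies -/

theorem isClosed_zariskiTopology_iff {F : Set (Spec A)} :
    IsClosed[zariskiTopology A] F ↔ ∃ a : A, F = vanishing a := by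
  rw [← @isOpen_compl_iff _ _ (zariskiTopology A)]
  change Fᶜᶜ ∈ {F : Set (Spec A) | ∃ a : A, F = vanishing a} ↔ _
  rw [compl_compl]
  rfl

theorem isCompact_compl_vanishing [IsCoherent A] {d : A} (hd : IsCompactElement d) :
    @IsCompact _ (zariskiTopology A) (vanishing d)ᶜ := by
  let _ := zariskiTopology A
  refine isCompact_of_finite_subcover fun {ι} U hU hcov => ?_
  have hU' : ∀ i, ∃ b : A, (U i)ᶜ = vanishing b := fun i =>
    isClosed_zariskiTopology_iff.1 (hU i).isClosed_compl
  choose b hb using hU'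
  have hmem : ∀ i (p : Spec A), p ∈ U i ↔ ¬ b i ≤ p.1 := fun i p => by
    rw [← Set.notMem_compl_iff, hb]
    rfl
  have hpow : ∃ n : ℕ, d ^ n ≤ ⨆ i, b i := by
    by_contra! H
    obtain ⟨p, hp, hbp, hdp⟩ := exists_isMPrime_not_le hd H
    obtain ⟨i, hi⟩ := Set.mem_iUnion.1 (hcov (show (⟨p, hp⟩ : Spec A) ∈ (vanishing d)ᶜ from hdp))
    exact (hmem _ _).1 hi ((le_iSup b i).trans hbp)
  obtain ⟨n, hn⟩ := hpow
  obtain ⟨t, ht⟩ := CompleteLattice.IsCompactElement.exists_finset_of_le_iSup A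
    (isCompactElement_pow hd n) b hn
  refine ⟨t, fun p hp => ?_⟩
  by_contra h
  simp only [Set.mem_iUnion, hmem, not_exists, not_not] at h
  exact hp (p.2.le_of_pow_le (ht.trans (iSup₂_le h)))

theorem isOpen_flatTopology_vanishing [IsCoherent A] {d : A} (hd : IsCompactElement d) :
    IsOpen[flatTopology A] (vanishing d) := by
  refine TopologicalSpace.isOpen_generateFrom_of_mem ⟨?_, isCompact_compl_vanishing hd⟩
  let _ := zariskiTopology A
  exact (isClosed_zariskiTopology_iff.2 ⟨d, rfl⟩ : IsClosed (vanishing d)).isOpen_compl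

/-- The sets `V(d)` with `d` compact form a basis of the flat topology. -/
theorem exists_vanishing_subset [IsCoherent A] {U : Set (Spec A)} (hU : IsOpen[flatTopology A] U)
    {q : Spec A} (hq : q ∈ U) :
    ∃ d : A, IsCompactElement d ∧ d ≤ q.1 ∧ vanishing d ⊆ U := by
  induction hU with
  | basic U hU =>
    let _ := zariskiTopology A
    obtain ⟨hUo, hUc⟩ := hU
    obtain ⟨b, hb⟩ : ∃ b : A, U = vanishing b :=
      isClosed_zariskiTopology_iff.1 (isOpen_compl_iff.1 hUo)
    obtain ⟨t, ht⟩ := hUc.elim_finite_subcover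
      (fun c : {c : A // IsCompactElement c ∧ c ≤ b} => (vanishing c.1)ᶜ)
      (fun c => (isClosed_zariskiTopology_iff.2 ⟨c.1, rfl⟩ :
        IsClosed (vanishing c.1)).isOpen_compl) (by
        intro p hp
        rw [hb] at hp
        obtain ⟨c, hc, hcb, hcp⟩ := exists_isCompactElement_le_not_le hp
        exact Set.mem_iUnion.2 ⟨⟨c, hc, hcb⟩, hcp⟩)
    rw [hb] at hq
    refine ⟨t.sup Subtype.val, CompleteLattice.isCompactElement_finsetSup t fun c _ => c.2.1,
      Finset.sup_le fun c _ => c.2.2.trans hq, fun p hp => ?_⟩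
    by_contra hpU
    obtain ⟨c, hc, hcp⟩ := Set.mem_iUnion₂.1 (ht hpU)
    exact hcp ((Finset.le_sup (f := Subtype.val) hc).trans hp)
  | univ =>
    refine ⟨⊥, ?_, bot_le, Set.subset_univ _⟩
    simpa using CompleteLattice.isCompactElement_finsetSup (f := id) (∅ : Finset A) (by simp)
  | inter U W _ _ ihU ihW =>
    obtain ⟨d, hd, hdq, hdU⟩ := ihU hq.1
    obtain ⟨e, he, heq, heW⟩ := ihW hq.2
    classical
    refine ⟨d ⊔ e, ?_, sup_le hdq heq, fun p hp => ⟨hdU (le_sup_left.trans hp),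
      heW (le_sup_right.trans hp)⟩⟩
    simpa using CompleteLattice.isCompactElement_finsetSup (f := id) ({d, e} : Finset A)
      (by simp [hd, he])
  | sUnion S _ ih =>
    obtain ⟨U, hUS, hqU⟩ := hq
    obtain ⟨d, hd, hdq, hdU⟩ := ih U hUS hqU
    exact ⟨d, hd, hdq, hdU.trans (Set.subset_sUnion_of_mem hUS)⟩

/-- For `p ∉ V(a)`, choose a compact `c ≤ a` with `c ≰ p`. Compactness of `1 = a ∨ c^⊥` gives a
compact `d ≤ c^⊥` with `a ∨ d = 1`, and `V(d)` is a neighbourhood of `p` missing `V(a)`. -/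
theorem IsPure.isClosed_flatTopology_vanishing [IsCoherent A] {a : A} (ha : IsPure a) :
    IsClosed[flatTopology A] (vanishing a) := by
  let _ := flatTopology A
  rw [← isOpen_compl_iff, isOpen_iff_forall_mem_open]
  intro p hp
  obtain ⟨c, hc, hca, hcp⟩ := exists_isCompactElement_le_not_le hp
  have hsup : ⊤ ≤ ⨆ d : {d : A // IsCompactElement d ∧ d ≤ perp c}, a ⊔ d.1 := by
    rw [← ha c hc hca]
    -- `sup_iSup` needs a nonempty index type.
    have : Nonempty {d : A // IsCompactElement d ∧ d ≤ perp c} := by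
      refine ⟨⊥, ?_, bot_le⟩
      simpa using CompleteLattice.isCompactElement_finsetSup (f := id) (∅ : Finset A) (by simp)
    rw [← sup_iSup]
    refine sup_le_sup_left (le_iff_compact_le_imp.2 fun d hd hdc => ?_) _
    exact le_iSup (fun d : {d : A // IsCompactElement d ∧ d ≤ perp c} => d.1) ⟨d, hd, hdc⟩
  obtain ⟨t, ht⟩ := CompleteLattice.IsCompactElement.exists_finset_of_le_iSup A
    IsCoherent.isCompactElement_top _ hsup
  have hle : ∀ d ∈ t, d.1 ≤ perp c := fun d _ => d.2.2
  refine ⟨vanishing (t.sup Subtype.val), fun q hq hqa => ?_, isOpen_flatTopology_vanishing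
    (CompleteLattice.isCompactElement_finsetSup t fun d _ => d.2.1), ?_⟩
  · refine q.2.1.not_ge (ht.trans (iSup₂_le fun d hd => sup_le hqa ?_))
    exact (Finset.le_sup (f := Subtype.val) hd).trans hq
  · refine (p.2.2 c _ ?_).resolve_left hcp
    exact (le_perp.1 (Finset.sup_le hle)).trans bot_le

theorem isPure_sInf_minSpec [IsCoherent A] (hA : IsPF A) {E : Set (Spec A)}
    (hE : IsClosed[flatTopology A] E) : IsPure (sInf (Subtype.val '' (minSpec A ∩ E))) := by
  intro c hc hca
  by_contra hne
  obtain ⟨m, hm, hsup⟩ := exists_isMPrime_of_ne_top hne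
  set q : Spec A := ⟨kernel m, isMPrime_kernel hA hm⟩ with hq
  have hcq : ¬ c ≤ kernel m := fun h => by
    obtain ⟨y, hy, hcy⟩ := (le_kernel_iff hm hc).1 h
    exact hy ((le_perp.2 hcy).trans (le_sup_right.trans hsup))
  have hqE : q ∈ Eᶜ := fun h =>
    hcq (hca.trans (sInf_le ⟨q, ⟨kernel_mem_minSpec hA hm, h⟩, rfl⟩))
  obtain ⟨d, hd, hdq, hdE⟩ := exists_vanishing_subset hE.isOpen_compl hqE
  obtain ⟨y, hy, hdy⟩ := (le_kernel_iff hm hd).1 hdq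
  refine hy (le_trans (le_sInf ?_) (le_sup_left.trans hsup))
  rintro _ ⟨p, ⟨-, hpE⟩, rfl⟩
  exact (p.2.2 d y (hdy.trans bot_le)).resolve_left fun h => hdE h hpE

end Quantale

theorem theorem6p10 (A : Type*) [CommMonoid A] [CompleteLattice A] [IsQuantale A]
    [Quantale.IsIntegral A] [Quantale.IsCoherent A] (hA : Quantale.IsPF A) (a : A) :
    Quantale.IsPure a ↔
      ∃ E : Set (Quantale.Spec A), IsClosed[Quantale.flatTopology A] E ∧
        a = sInf (Subtype.val '' (Quantale.minSpec A ∩ E)) := by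
  constructor
  · intro ha
    exact ⟨Quantale.vanishing a, ha.isClosed_flatTopology_vanishing, ha.eq_sInf_minSpec hA⟩
  · rintro ⟨E, hE, rfl⟩
    exact Quantale.isPure_sInf_minSpec hA hE
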